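/- For a prime $p$ let $\mathbb F_p$ be the field with $p$ elements. A map $\phi=(f_1,\dots,f_k):\mathbb F_p^n\to\mathbb F_p^k$ has degree at most $d$ if its coordinate functions $f_1,\dots,f_k$ can be given by polynomials in $\mathbb F_p[x_1,\dots,x_n]$ of total degree at most $d$; let $\mathrm{Pol}_{\le d}(\mathbb F_p^n,\mathbb F_p^k)$ be the set of such maps. For $d\ge 1$ and $\phi\in\mathrm{Pol}_{\le d}(\mathbb F_p^n,\mathbb F_p^k)$, the analytic rank of $\phi$ is $$\mathrm{arank}_d(\phi)=-\log_p\Big(\max_{\psi:\mathbb F_p^n\to\mathbb F_p^k,\ \deg\psi<d}\ \Pr_{x\in\mathbb F_p^n}[\phi(x)=\psi(x)]\Big),$$ where $x$ is uniformly distributed over $\mathbb F_p^n$ and $\psi$ ranges over polynomial maps of degree less than $d$. For $\rho\in[0,1]$, write $Z\sim\mathcal N_\rho(0)$ for the random vector in $\mathbb F_p^n$ with independent coordinates, each of which equals $0$ with probability $\rho$ and is uniformly distributed over $\mathbb F_p$ with probability $1-\rho$. **Lemma (Biased equidistribution).** For every integer $d\ge 1$ and all $\rho,\varepsilon\in(0,1)$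 there exists a constant $R_0=R_0(d,\rho,\varepsilon)>0$ such that the following holds for every prime $p$ and all integers $n,k\ge 0$. If $\phi\in\mathrm{Pol}_{\le d}(\mathbb F_p^n,\mathbb F_p^k)$ satisfies $\mathrm{arank}_d(\phi)\ge R_0$, then $$\Pr_{Z\sim\mathcal N_\rho(0)}[\phi(y+Z)=w]\le\varepsilon\qquad\text{for all } y\in\mathbb F_p^n,\ w\in\mathbb F_p^k.$$ -/

import Mathlib

open scoped Classical in
/-- The probability that `P x` holds for a uniformly random element `x` of a finite type. -/
noncomputable def uniformProb {α : Type*} [Fintype α] (P : α → Prop) : ℝ :=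
  ((Finset.univ.filter P).card : ℝ) / (Fintype.card α : ℝ)

/-- `polyMaps p n k d` is the set of polynomial maps `𝔽_p^n → 𝔽_p^k` of degree at most `d`:
the maps `x ↦ (f_1(x), …, f_k(x))` where each `f_i` is a polynomial in `n` variables of total
degree at most `d`. -/
def polyMaps (p n k d : ℕ) : Set ((Fin n → ZMod p) → (Fin k → ZMod p)) :=
  {φ | ∃ f : Fin k → MvPolynomial (Fin n) (ZMod p),
    (∀ i, (f i).totalDegree ≤ d) ∧ ∀ x i, φ x i = MvPolynomial.eval x (f i)}

/-- The polynomial maps `𝔽_p^n → 𝔽_p^k` of degree strictly less than `d`. -/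
def lowerPolyMaps (p n k d : ℕ) : Set ((Fin n → ZMod p) → (Fin k → ZMod p)) :=
  {ψ | ∃ e < d, ψ ∈ polyMaps p n k e}

/-- The analytic rank
`-log_p (max_{deg ψ < d} Pr_x [φ x = ψ x])`, with `x` uniform over `𝔽_p^n`.
(For `d ≥ 1` the supremum is over a finite non-empty family, so it is a maximum.) -/
noncomputable def analyticRank (p n k d : ℕ) [Fact p.Prime]
    (φ : (Fin n → ZMod p) → (Fin k → ZMod p)) : ℝ :=
  -Real.logb (p : ℝ)
    (⨆ ψ : lowerPolyMaps p n k d, uniformProb (fun x : Fin n → ZMod p => φ x = ψ.1 x))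

open scoped Classical in
/-- One coordinate of the symmetric channel with bias `ρ`: the probability that the symbol `a` is
received as `b`. With probability `ρ` the symbol is left unchanged, and with probability `1 - ρ`
it is replaced with a uniformly random symbol of the alphabet. -/
noncomputable def channelSymbolProb {A : Type*} [Fintype A] (ρ : ℝ) (a b : A) : ℝ :=
  ρ * (if b = a then 1 else 0) + (1 - ρ) * (1 / (Fintype.card A : ℝ))

/-- The probability mass function of `𝒩_ρ(c)`, the output of the symmetric channel with bias `ρ`
on the word `c`; the coordinates are corrupted independently. -/
noncomputable def channelProb {A : Type*} [Fintype A] {n : ℕ} (ρ : ℝ) (c z : Fin n → A) : ℝ :=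
  ∏ i, channelSymbolProb ρ (c i) (z i)

open scoped Classical in
/-- The probability that `P Z` holds for `Z ∼ 𝒩_ρ(c)`. -/
noncomputable def noiseProb {A : Type*} [Fintype A] {n : ℕ} (ρ : ℝ) (c : Fin n → A)
    (P : (Fin n → A) → Prop) : ℝ :=
  ∑ z ∈ Finset.univ.filter P, channelProb ρ c z

/-! Write the degree as `d + 1`, and let r(I) be the analytic rank of φ with the coordinates outside
I set to 0. A sample of 𝒩_ρ(0) is uniform on a random set I of coordinates, of density 1 - ρ, and 0
elsewhere. A translate of φ differs from φ by a map of lower degree, so given I an atom has mass at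
most p^(-r(I)) ≤ 2^(-r(I)). Passing to 2 makes all later bounds independent of p.

The function r is monotone and grows by at most 1 per added coordinate. Hence u = 2^(-r) satisfies
E_s[1/u] · E_t[u] ≤ 1 whenever s ≤ t/2 (`bernoulliSum_inv_mul_le_one`). With t = 1 - ρ, an atom of
mass at least ε forces E_s[r] ≤ E_s[2^r] ≤ 1/ε for every s ≤ (1 - ρ)/2: sparse restrictions have
bounded rank on average.

To return to φ itself, colour the coordinates at random with M colours, M so large that any `d + 1`
classes together are sparse. An alternating sum over a cube of dimension `d + 2` vanishes on φ,
which expresses the restriction to a set of colours through restrictions to fewer colours. Rank is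
subadditive, so iterating bounds the rank of φ by a constant times the sum of the ranks over sets of
at most `d + 1` colours. Averaging over colourings bounds the rank of φ. -/

/-! ### Polynomial functions, differencing and alternating sums -/

/-- `IsPolyLT e f`: the function `f` is given by a polynomial of total degree less than `e`. -/
inductive IsPolyLT {ι R : Type*} [CommRing R] : ℕ → ((ι → R) → R) → Prop
  | zero (e : ℕ) : IsPolyLT e (fun _ => 0)
  | const (e : ℕ) (c : R) : IsPolyLT (e + 1) (fun _ => c)
  | add {e : ℕ} {f g : (ι → R) → R} : IsPolyLT e f → IsPolyLT e g → IsPolyLT e (fun x => f x + g x)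
  | coord_mul {e : ℕ} {f : (ι → R) → R} (i : ι) : IsPolyLT e f → IsPolyLT (e + 1) (fun x => x i * f x)

namespace IsPolyLT

variable {ι R : Type*} [CommRing R] {e e' : ℕ} {f g : (ι → R) → R}

theorem mono (hf : IsPolyLT e f) (h : e ≤ e') : IsPolyLT e' f := by
  induction hf generalizing e' with
  | zero e => exact zero _
  | const e c =>
    obtain ⟨m, rfl⟩ := Nat.exists_eq_add_of_le' (show 1 ≤ e' by omega)
    exact const m c
  | add _ _ ih₁ ih₂ => exact (ih₁ h).add (ih₂ h)
  | coord_mul i _ ih =>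
    obtain ⟨m, rfl⟩ := Nat.exists_eq_add_of_le' (show 1 ≤ e' by omega)
    exact coord_mul i (ih (by omega))

theorem const_mul (c : R) (hf : IsPolyLT e f) : IsPolyLT e (fun x => c * f x) := by
  induction hf with
  | zero e => simpa using zero e
  | const e c' => exact const e (c * c')
  | add _ _ ih₁ ih₂ => simpa only [mul_add] using ih₁.add ih₂
  | coord_mul i _ ih => simpa only [mul_left_comm] using coord_mul i ih

theorem neg (hf : IsPolyLT e f) : IsPolyLT e (fun x => -f x) := by
  simpa using hf.const_mul (-1)

theorem sub (hf : IsPolyLT e f) (hg : IsPolyLT e g) : IsPolyLT e (fun x => f x - g x) := by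
  simpa only [sub_eq_add_neg] using hf.add hg.neg

theorem sum {α : Type*} (s : Finset α) {F : α → (ι → R) → R} (h : ∀ a ∈ s, IsPolyLT e (F a)) :
    IsPolyLT e (fun x => ∑ a ∈ s, F a x) := by
  classical
  induction s using Finset.induction_on with
  | empty => simpa using zero e
  | insert a s ha ih =>
    simp only [Finset.sum_insert ha]
    exact (h a (by simp)).add (ih fun b hb => h b (by simp [hb]))

theorem eq_zero (hf : IsPolyLT 0 f) : f = fun _ => 0 := by
  generalize h : 0 = e at hf
  induction hf with
  | zero e => rfl
  | const e c => omega
  | add _ _ ih₁ ih₂ => simp [ih₁ h, ih₂ h]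
  | coord_mul i _ ih => omega

/-- Differencing lowers the degree. -/
theorem diff (hf : IsPolyLT (e + 1) f) (h : ι → R) : IsPolyLT e (fun x => f (x + h) - f x) := by
  generalize hn : e + 1 = n at hf
  induction hf generalizing e with
  | zero => simpa using zero e
  | const => simpa using zero e
  | add _ _ ih₁ ih₂ =>
    have := (ih₁ hn).add (ih₂ hn)
    convert this using 2
    ring
  | @coord_mul m f i hf ih =>
    obtain rfl : e = m := by omega
    rcases e with _ | e
    · simpa [hf.eq_zero] using zero 0
    -- Leibniz rule: with Δf = f(x + h) - f(x), the difference of x_i f is x_i Δf + h_i (Δf + f).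
    · have h₁ := ih rfl
      have h₂ := (coord_mul i h₁).add (((h₁.mono (Nat.le_succ e)).add hf).const_mul (h i))
      convert h₂ using 2
      simp only [Pi.add_apply]
      ring

theorem comp_add_right (hf : IsPolyLT e f) (h : ι → R) : IsPolyLT e (fun x => f (x + h)) := by
  have := ((hf.mono (Nat.le_succ e)).diff h).add hf
  simpa using this

theorem comp_linear {κ : Type*} (hf : IsPolyLT e f) (T : (κ → R) → ι → R)
    (hT : ∀ i, (∃ j, ∀ x, T x i = x j) ∨ ∀ x, T x i = 0) : IsPolyLT e (fun x => f (T x)) := by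
  induction hf with
  | zero e => exact zero e
  | const e c => exact const e c
  | add _ _ ih₁ ih₂ => exact ih₁.add ih₂
  | @coord_mul m f i hf ih =>
    rcases hT i with ⟨j, hj⟩ | h0
    · simpa only [hj] using coord_mul j ih
    · simpa only [h0, zero_mul] using zero _

theorem of_monomial (m : ι →₀ ℕ) (h : m.degree < e) :
    IsPolyLT e (fun x : ι → R => m.prod fun i k => x i ^ k) := by
  induction e generalizing m with
  | zero => omega
  | succ e ih =>
    by_cases hm : m = 0
    · subst hm
      simpa using const e (1 : R)
    · obtain ⟨i, hi⟩ := Finsupp.ne_iff.1 hm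
      have hle : Finsupp.single i 1 ≤ m := by
        rw [Finsupp.single_le_iff]
        simp only [Finsupp.coe_zero, Pi.zero_apply] at hi
        omega
      obtain ⟨m', rfl⟩ := exists_add_of_le hle
      have hm' : m'.degree < e := by
        rw [map_add, Finsupp.degree_single] at h
        omega
      convert coord_mul i (ih m' hm') using 2 with x
      rw [Finsupp.prod_add_index' (by simp) (by intros; rw [pow_add])]
      simp

theorem of_mvPolynomial (q : MvPolynomial ι R) (h : q.totalDegree < e) :
    IsPolyLT e (fun x => MvPolynomial.eval x q) := by
  refine sum q.support fun m hm => const_mul _ (of_monomial m (lt_of_le_of_lt ?_ h))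
  exact MvPolynomial.le_totalDegree hm

theorem exists_mvPolynomial (hf : IsPolyLT (e + 1) f) :
    ∃ q : MvPolynomial ι R, q.totalDegree ≤ e ∧ ∀ x, f x = MvPolynomial.eval x q := by
  generalize hn : e + 1 = n at hf
  induction hf generalizing e with
  | zero => exact ⟨0, by simp, by simp⟩
  | const m c => exact ⟨MvPolynomial.C c, by simp, by simp⟩
  | add _ _ ih₁ ih₂ =>
    obtain ⟨q₁, h₁, h₁'⟩ := ih₁ hn
    obtain ⟨q₂, h₂, h₂'⟩ := ih₂ hn
    exact ⟨q₁ + q₂, (MvPolynomial.totalDegree_add _ _).trans (max_le h₁ h₂), by simp [h₁', h₂']⟩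
  | @coord_mul m f i hf ih =>
    obtain rfl : e = m := by omega
    rcases e with _ | e
    · exact ⟨0, by simp, by simp [hf.eq_zero]⟩
    · obtain ⟨q, h, h'⟩ := ih rfl
      refine ⟨MvPolynomial.X i * q, (MvPolynomial.totalDegree_mul _ _).trans ?_, by simp [h']⟩
      have : (MvPolynomial.X i : MvPolynomial ι R).totalDegree ≤ 1 := by
        rcases subsingleton_or_nontrivial R with hR | hR
        · simp [Subsingleton.elim (MvPolynomial.X i : MvPolynomial ι R) 0]
        · simp
      omega

/-- The alternating sum of a polynomial of degree less than `#T` over a `#T`-dimensional cube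
vanishes. -/
theorem alternating_sum {κ : Type*} [DecidableEq κ] (T : Finset κ) (h : κ → ι → R)
    (hf : IsPolyLT T.card f) (x : ι → R) :
    ∑ U ∈ T.powerset, (-1) ^ U.card * f (x + ∑ j ∈ U, h j) = 0 := by
  induction T using Finset.induction_on generalizing f with
  | empty => simp [show f = fun _ => 0 from eq_zero (by simpa using hf)]
  | insert a T ha ih =>
    rw [Finset.card_insert_of_notMem ha] at hf
    rw [Finset.sum_powerset_insert ha, ← neg_eq_zero, ← ih (hf.diff (h a)), ← Finset.sum_add_distrib,
      ← Finset.sum_neg_distrib]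
    refine Finset.sum_congr rfl fun U hU => ?_
    have haU : a ∉ U := fun h' => ha (Finset.mem_powerset.1 hU h')
    rw [Finset.card_insert_of_notMem haU, Finset.sum_insert haU, add_assoc, add_comm (h a)]
    ring

end IsPolyLT

/-! ### Uniform probabilities -/

section UniformProb

variable {α : Type*} [Fintype α] {P Q : α → Prop}

theorem uniformProb_mono (h : ∀ x, P x → Q x) : uniformProb P ≤ uniformProb Q := by
  classical
  unfold uniformProb
  gcongr with x
  exact h x

theorem uniformProb_true [Nonempty α] : uniformProb (fun _ : α => True) = 1 := by
  simp [uniformProb]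

theorem uniformProb_le_one : uniformProb P ≤ 1 := by
  rcases isEmpty_or_nonempty α with h | h
  · simp [uniformProb]
  · exact (uniformProb_mono fun _ _ => trivial).trans_eq uniformProb_true

theorem uniformProb_pos {x : α} (hx : P x) : 0 < uniformProb P := by
  classical
  unfold uniformProb
  have : 0 < (Finset.univ.filter P).card := Finset.card_pos.2 ⟨x, by simpa using hx⟩
  have : 0 < Fintype.card α := Fintype.card_pos_iff.2 ⟨x⟩
  positivity

theorem card_filter_eq_uniformProb_mul [Nonempty α] [DecidablePred P] :
    ((Finset.univ.filter P).card : ℝ) = uniformProb P * Fintype.card α := by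
  have : (Fintype.card α : ℝ) ≠ 0 := by simp
  unfold uniformProb
  rw [div_mul_cancel₀ _ this]
  congr!

theorem uniformProb_comp_equiv (e : α ≃ α) : uniformProb (fun x => P (e x)) = uniformProb P := by
  classical
  unfold uniformProb
  congr 2
  refine Finset.card_bij (fun x _ => e x) (by simp) (by simp) fun y hy => ⟨e.symm y, ?_⟩
  simpa using hy

/-- Two events can be made to overlap at least as much as independent ones by shifting one. -/
theorem exists_uniformProb_mul_le {G : Type*} [AddCommGroup G] [Fintype G] (P Q : G → Prop)
    (T : G → G) :
    ∃ h, uniformProb P * uniformProb Q ≤ uniformProb (fun x => P x ∧ Q (T x + h)) := by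
  classical
  by_contra! hlt
  -- For fixed x, `T x + h` runs over all of G as h does, so the average over h is exactly the
  -- product.
  have h₁ : ∑ h, (Finset.univ.filter fun x => P x ∧ Q (T x + h)).card
      = (Finset.univ.filter P).card * (Finset.univ.filter Q).card := by
    simp only [Finset.card_filter]
    rw [Finset.sum_comm, Finset.sum_mul]
    refine Finset.sum_congr rfl fun x _ => ?_
    by_cases hx : P x
    · simp only [hx, true_and, if_true, one_mul]
      exact Equiv.sum_comp (Equiv.addLeft (T x)) fun z => if Q z then 1 else 0
    · simp [hx]
  have h₂ := Finset.sum_lt_sum_of_nonempty (Finset.univ_nonempty (α := G)) fun h _ => hlt h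
  have h₃ := congrArg (Nat.cast (R := ℝ)) h₁
  push_cast at h₃
  simp only [card_filter_eq_uniformProb_mul, ← Finset.sum_mul] at h₃
  simp only [Finset.sum_const, Finset.card_univ, nsmul_eq_mul] at h₂
  have hG : 0 < (Fintype.card G : ℝ) := by exact_mod_cast Fintype.card_pos
  have := mul_lt_mul_of_pos_right h₂ hG
  nlinarith

theorem uniformProb_apply_eq_zero {ι R : Type*} [Fintype ι] [DecidableEq ι] [Fintype R]
    [AddCommGroup R] (i : ι) :
    uniformProb (fun x : ι → R => x i = 0) = 1 / Fintype.card R := by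
  classical
  have h₁ : ∀ c : R, uniformProb (fun x : ι → R => x i = c) =
      uniformProb (fun x : ι → R => x i = 0) := by
    intro c
    rw [← uniformProb_comp_equiv (Equiv.addRight (Pi.single i c : ι → R))]
    simp
  have h₂ := Finset.card_eq_sum_card_fiberwise (s := (Finset.univ : Finset (ι → R)))
    (t := (Finset.univ : Finset R)) (f := fun x => x i) (by simp)
  have h₃ := congrArg (Nat.cast (R := ℝ)) h₂
  push_cast at h₃
  simp only [card_filter_eq_uniformProb_mul, ← Finset.sum_mul, h₁] at h₃
  have hG : 0 < (Fintype.card (ι → R) : ℝ) := by exact_mod_cast Fintype.card_pos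
  have hR : (Fintype.card R : ℝ) ≠ 0 := by simp
  simp only [Finset.card_univ, Finset.sum_const, nsmul_eq_mul] at h₃
  rw [eq_div_iff hR]
  apply mul_right_cancel₀ hG.ne'
  linarith

end UniformProb

/-! ### Polynomial maps and restriction to sets of coordinates -/

/-- Maps all of whose coordinate functions are polynomials of degree less than `e`. -/
def IsPolyMapLT {ι κ R : Type*} [CommRing R] (e : ℕ) (φ : (ι → R) → κ → R) : Prop :=
  ∀ j, IsPolyLT e (fun x => φ x j)

namespace IsPolyMapLT

variable {ι κ R : Type*} [CommRing R] {e : ℕ} {φ ψ : (ι → R) → κ → R}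

theorem add (h₁ : IsPolyMapLT e φ) (h₂ : IsPolyMapLT e ψ) : IsPolyMapLT e (φ + ψ) :=
  fun j => (h₁ j).add (h₂ j)

theorem sub (h₁ : IsPolyMapLT e φ) (h₂ : IsPolyMapLT e ψ) : IsPolyMapLT e (φ - ψ) :=
  fun j => (h₁ j).sub (h₂ j)

theorem neg (h₁ : IsPolyMapLT e φ) : IsPolyMapLT e (-φ) := fun j => (h₁ j).neg

theorem zero : IsPolyMapLT e (0 : (ι → R) → κ → R) := fun _ => IsPolyLT.zero e

theorem const (w : κ → R) : IsPolyMapLT (e + 1) (fun _ : ι → R => w) :=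
  fun j => IsPolyLT.const e (w j)

theorem sum {α : Type*} (s : Finset α) {F : α → (ι → R) → κ → R}
    (h : ∀ a ∈ s, IsPolyMapLT e (F a)) : IsPolyMapLT e (∑ a ∈ s, F a) := by
  intro j
  simpa using IsPolyLT.sum s fun a ha => h a ha j

theorem comp_add_right (hφ : IsPolyMapLT e φ) (h : ι → R) : IsPolyMapLT e (fun x => φ (x + h)) :=
  fun j => (hφ j).comp_add_right h

theorem diff (hφ : IsPolyMapLT (e + 1) φ) (h : ι → R) :
    IsPolyMapLT e (fun x => φ (x + h) - φ x) := fun j => (hφ j).diff h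

end IsPolyMapLT

theorem mem_polyMaps_iff {p n k d : ℕ} {φ : (Fin n → ZMod p) → Fin k → ZMod p} :
    φ ∈ polyMaps p n k d ↔ IsPolyMapLT (d + 1) φ := by
  constructor
  · rintro ⟨f, hf, h⟩ j
    simp only [h]
    exact IsPolyLT.of_mvPolynomial (f j) (Nat.lt_succ_of_le (hf j))
  · intro h
    choose f hf h' using fun j => (h j).exists_mvPolynomial
    exact ⟨f, hf, fun x i => h' i x⟩

theorem mem_lowerPolyMaps_iff {p n k d : ℕ} {φ : (Fin n → ZMod p) → Fin k → ZMod p} :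
    φ ∈ lowerPolyMaps p n k (d + 1) ↔ IsPolyMapLT (d + 1) φ := by
  constructor
  · rintro ⟨e, he, h⟩ j
    exact (mem_polyMaps_iff.1 h j).mono (by omega)
  · exact fun h => ⟨d, by omega, mem_polyMaps_iff.2 h⟩

/-- `x` with the coordinates outside `I` replaced with `0`. -/
def zeroOutside {ι R : Type*} [DecidableEq ι] [Zero R] (I : Finset ι) (x : ι → R) : ι → R :=
  fun i => if i ∈ I then x i else 0

theorem zeroOutside_univ {ι R : Type*} [Fintype ι] [DecidableEq ι] [Zero R] (x : ι → R) :
    zeroOutside Finset.univ x = x := by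
  ext i
  simp [zeroOutside]

theorem zeroOutside_add {ι R : Type*} [DecidableEq ι] [AddCommGroup R] (I : Finset ι)
    (x y : ι → R) : zeroOutside I (x + y) = zeroOutside I x + zeroOutside I y := by
  ext i
  by_cases h : i ∈ I <;> simp [zeroOutside, h]

theorem zeroOutside_zeroOutside {ι R : Type*} [DecidableEq ι] [AddCommGroup R] {I J : Finset ι}
    (h : J ⊆ I) (x : ι → R) : zeroOutside I (zeroOutside J x) = zeroOutside J x := by
  ext i
  by_cases h' : i ∈ J
  · simp [zeroOutside, h', h h']
  · simp [zeroOutside, h']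

theorem IsPolyMapLT.comp_zeroOutside {ι κ R : Type*} [DecidableEq ι] [CommRing R] {e : ℕ}
    {φ : (ι → R) → κ → R} (hφ : IsPolyMapLT e φ) (I : Finset ι) :
    IsPolyMapLT e (fun x => φ (zeroOutside I x)) := by
  refine fun j => (hφ j).comp_linear _ fun i => ?_
  by_cases h : i ∈ I
  · exact Or.inl ⟨i, by simp [zeroOutside, h]⟩
  · exact Or.inr (by simp [zeroOutside, h])

/-! ### Properties of the analytic rank -/

section AnalyticRank

variable {p n k d : ℕ} [Fact p.Prime] {φ φ' ψ : (Fin n → ZMod p) → Fin k → ZMod p}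

theorem one_lt_cast_prime (p : ℕ) [hp : Fact p.Prime] : (1 : ℝ) < p := by
  exact_mod_cast hp.out.one_lt

theorem le_iSup_uniformProb (hψ : IsPolyMapLT (d + 1) ψ) :
    uniformProb (fun x => φ x = ψ x) ≤
      ⨆ ψ : lowerPolyMaps p n k (d + 1), uniformProb (fun x : Fin n → ZMod p => φ x = ψ.1 x) :=
  le_ciSup (f := fun ψ : lowerPolyMaps p n k (d + 1) =>
      uniformProb (fun x : Fin n → ZMod p => φ x = ψ.1 x))
    ⟨1, by rintro _ ⟨ψ, rfl⟩; exact uniformProb_le_one⟩ ⟨ψ, mem_lowerPolyMaps_iff.2 hψ⟩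

theorem rpow_neg_analyticRank (φ : (Fin n → ZMod p) → Fin k → ZMod p) :
    (p : ℝ) ^ (-analyticRank p n k (d + 1) φ) =
      ⨆ ψ : lowerPolyMaps p n k (d + 1), uniformProb (fun x : Fin n → ZMod p => φ x = ψ.1 x) := by
  have hp := one_lt_cast_prime p
  rw [analyticRank, neg_neg, Real.rpow_logb (by linarith) hp.ne']
  -- The supremum must be positive for the logarithm to be inverted; the constant φ(0) agrees with φ
  -- at 0.
  refine lt_of_lt_of_le ?_ (le_iSup_uniformProb (IsPolyMapLT.const (φ 0)))
  exact uniformProb_pos (x := 0) rfl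

theorem uniformProb_le_rpow_neg_analyticRank (hψ : IsPolyMapLT (d + 1) ψ) :
    uniformProb (fun x => φ x = ψ x) ≤ (p : ℝ) ^ (-analyticRank p n k (d + 1) φ) := by
  rw [rpow_neg_analyticRank]
  exact le_iSup_uniformProb hψ

variable (d φ) in
theorem exists_uniformProb_eq_rpow :
    ∃ ψ : (Fin n → ZMod p) → Fin k → ZMod p, IsPolyMapLT (d + 1) ψ ∧
      uniformProb (fun x => φ x = ψ x) = (p : ℝ) ^ (-analyticRank p n k (d + 1) φ) := by
  have : Nonempty (lowerPolyMaps p n k (d + 1)) := ⟨⟨0, mem_lowerPolyMaps_iff.2 .zero⟩⟩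
  obtain ⟨ψ, hψ⟩ := exists_eq_ciSup_of_finite (f := fun ψ : lowerPolyMaps p n k (d + 1) =>
      uniformProb (fun x : Fin n → ZMod p => φ x = ψ.1 x))
  exact ⟨ψ.1, mem_lowerPolyMaps_iff.1 ψ.2, by rw [rpow_neg_analyticRank, hψ]⟩

theorem analyticRank_le_of_rpow_le {r : ℝ} (hψ : IsPolyMapLT (d + 1) ψ)
    (h : (p : ℝ) ^ (-r) ≤ uniformProb (fun x => φ x = ψ x)) :
    analyticRank p n k (d + 1) φ ≤ r := by
  have := h.trans (uniformProb_le_rpow_neg_analyticRank hψ)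
  rw [Real.rpow_le_rpow_left_iff (one_lt_cast_prime p)] at this
  linarith

theorem analyticRank_nonneg : 0 ≤ analyticRank p n k (d + 1) φ := by
  obtain ⟨ψ, -, h⟩ := exists_uniformProb_eq_rpow d φ
  have h₁ : (p : ℝ) ^ (-analyticRank p n k (d + 1) φ) ≤ (p : ℝ) ^ (0 : ℝ) := by
    rw [← h, Real.rpow_zero]
    exact uniformProb_le_one
  rw [Real.rpow_le_rpow_left_iff (one_lt_cast_prime p)] at h₁
  linarith

theorem analyticRank_zero : analyticRank p n k (d + 1) 0 = 0 := by
  refine le_antisymm (analyticRank_le_of_rpow_le (ψ := 0) .zero ?_) analyticRank_nonneg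
  simp [uniformProb_true]

theorem analyticRank_neg : analyticRank p n k (d + 1) (-φ) = analyticRank p n k (d + 1) φ := by
  have key : ∀ φ : (Fin n → ZMod p) → Fin k → ZMod p,
      analyticRank p n k (d + 1) (-φ) ≤ analyticRank p n k (d + 1) φ := by
    intro φ
    obtain ⟨ψ, hψ, h⟩ := exists_uniformProb_eq_rpow d φ
    refine analyticRank_le_of_rpow_le hψ.neg ?_
    simp [h]
  refine le_antisymm (key φ) ?_
  simpa using key (-φ)

/-- The two agreement sets need not meet. Translating the second by a suitable u makes them overlap
as much as independent sets would, and replacing φ' by its translate costs only a map of lower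
degree. -/
theorem analyticRank_add_le (hφ' : IsPolyMapLT (d + 2) φ') :
    analyticRank p n k (d + 1) (φ + φ') ≤
      analyticRank p n k (d + 1) φ + analyticRank p n k (d + 1) φ' := by
  obtain ⟨ψ, hψ, h⟩ := exists_uniformProb_eq_rpow d φ
  obtain ⟨ψ', hψ', h'⟩ := exists_uniformProb_eq_rpow d φ'
  obtain ⟨u, hu⟩ := exists_uniformProb_mul_le (fun x => φ x = ψ x) (fun x => φ' x = ψ' x) id
  refine analyticRank_le_of_rpow_le
    (ψ := ψ + (fun x => ψ' (x + u)) - fun x => φ' (x + u) - φ' x)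
    ((hψ.add (hψ'.comp_add_right u)).sub (hφ'.diff u)) ?_
  have hp := one_lt_cast_prime p
  rw [neg_add, Real.rpow_add (by linarith), ← h, ← h']
  refine hu.trans (uniformProb_mono fun x hx => ?_)
  obtain ⟨h₁, h₂⟩ := hx
  simp only [id] at h₂
  simp only [Pi.add_apply, Pi.sub_apply, h₁, h₂]
  abel

theorem analyticRank_sum_le {α : Type*} (s : Finset α)
    {F : α → (Fin n → ZMod p) → Fin k → ZMod p} (h : ∀ a ∈ s, IsPolyMapLT (d + 2) (F a)) :
    analyticRank p n k (d + 1) (∑ a ∈ s, F a) ≤ ∑ a ∈ s, analyticRank p n k (d + 1) (F a) := by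
  classical
  induction s using Finset.induction_on with
  | empty => simp [analyticRank_zero]
  | insert a s ha ih =>
    rw [Finset.sum_insert ha, Finset.sum_insert ha]
    have hs : ∀ b ∈ s, IsPolyMapLT (d + 2) (F b) := fun b hb => h b (by simp [hb])
    linarith [ih hs, analyticRank_add_le (φ := F a) (IsPolyMapLT.sum s hs)]

/-- On some translate of the subspace supported on J, an optimal approximation for I is at least as
good as on average; moving that translate back to the origin changes φ by lower degree. -/
theorem analyticRank_zeroOutside_mono (hφ : IsPolyMapLT (d + 2) φ) {I J : Finset (Fin n)}
    (h : J ⊆ I) : analyticRank p n k (d + 1) (fun x => φ (zeroOutside J x)) ≤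
      analyticRank p n k (d + 1) (fun x => φ (zeroOutside I x)) := by
  obtain ⟨ψ, hψ, hr⟩ := exists_uniformProb_eq_rpow d fun x => φ (zeroOutside I x)
  obtain ⟨u, hu⟩ := exists_uniformProb_mul_le (fun _ => True)
    (fun x => φ (zeroOutside I x) = ψ x) (zeroOutside J)
  refine analyticRank_le_of_rpow_le
    (ψ := (fun x => ψ (zeroOutside J x + u)) -
      fun x => φ (zeroOutside J x + zeroOutside I u) - φ (zeroOutside J x))
    (((hψ.comp_add_right u).comp_zeroOutside J).sub
      ((hφ.diff (zeroOutside I u)).comp_zeroOutside J)) ?_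
  rw [← hr]
  rw [uniformProb_true, one_mul] at hu
  refine hu.trans (uniformProb_mono fun x hx => ?_)
  rw [zeroOutside_add, zeroOutside_zeroOutside h] at hx
  simp [← hx.2]

/-- The two restrictions agree when x_i = 0, an event of probability 1/p, so their difference has
rank at most 1. -/
theorem analyticRank_zeroOutside_insert_le (hφ : IsPolyMapLT (d + 2) φ) (i : Fin n)
    (I : Finset (Fin n)) :
    analyticRank p n k (d + 1) (fun x => φ (zeroOutside (insert i I) x)) ≤
      analyticRank p n k (d + 1) (fun x => φ (zeroOutside I x)) + 1 := by
  set F := fun x => φ (zeroOutside (insert i I) x)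
  set G := fun x => φ (zeroOutside I x)
  have h₁ := analyticRank_add_le (φ := G)
    ((hφ.comp_zeroOutside (insert i I)).sub (hφ.comp_zeroOutside I))
  have h₂ : analyticRank p n k (d + 1) (F - G) ≤ 1 := by
    refine analyticRank_le_of_rpow_le (ψ := 0) .zero ?_
    have h₃ := uniformProb_apply_eq_zero (R := ZMod p) i
    rw [ZMod.card, one_div] at h₃
    rw [Real.rpow_neg_one, ← h₃]
    refine uniformProb_mono fun x hx => ?_
    have : zeroOutside (insert i I) x = zeroOutside I x := by
      ext j
      by_cases hj : j = i
      · simp [zeroOutside, hj, hx]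
      · simp [zeroOutside, hj]
    simp [F, G, this]
  have h₃ : G + (F - G) = F := by abel
  change analyticRank p n k (d + 1) (G + (F - G)) ≤ _ at h₁
  rw [h₃] at h₁
  linarith

/-- The event says that φ agrees on I with w - (φ(x + y) - φ(x)), a map of lower degree. -/
theorem uniformProb_zeroOutside_le (hφ : IsPolyMapLT (d + 2) φ) (I : Finset (Fin n))
    (y : Fin n → ZMod p) (w : Fin k → ZMod p) :
    uniformProb (fun x => φ (y + zeroOutside I x) = w) ≤
      (p : ℝ) ^ (-analyticRank p n k (d + 1) (fun x => φ (zeroOutside I x))) := by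
  refine le_trans (uniformProb_mono fun x hx => ?_) (uniformProb_le_rpow_neg_analyticRank
    (ψ := (fun _ => w) - fun x => φ (zeroOutside I x + y) - φ (zeroOutside I x))
    ((IsPolyMapLT.const w).sub ((hφ.diff y).comp_zeroOutside I)))
  simp [← hx, add_comm y]

end AnalyticRank

/-! ### Averages over random sets -/

section BernoulliSum

variable {α : Type*}

/-- The expectation of `u I`, where `I` is a random subset of `A` that contains each element
independently with probability `s`. -/
noncomputable def bernoulliSum (s : ℝ) (A : Finset α) (u : Finset α → ℝ) : ℝ :=
  ∑ I ∈ A.powerset, s ^ I.card * (1 - s) ^ (A.card - I.card) * u I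

theorem bernoulliSum_insert [DecidableEq α] (s : ℝ) {A : Finset α} {a : α} (ha : a ∉ A)
    (u : Finset α → ℝ) :
    bernoulliSum s (insert a A) u =
      (1 - s) * bernoulliSum s A u + s * bernoulliSum s A fun I => u (insert a I) := by
  simp only [bernoulliSum]
  rw [Finset.sum_powerset_insert ha, Finset.mul_sum, Finset.mul_sum, Finset.card_insert_of_notMem ha]
  congr 1
  · refine Finset.sum_congr rfl fun I hI => ?_
    rw [Nat.succ_sub (Finset.card_le_card (Finset.mem_powerset.1 hI)), pow_succ]
    ring
  · refine Finset.sum_congr rfl fun I hI => ?_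
    rw [Finset.card_insert_of_notMem fun h => ha (Finset.mem_powerset.1 hI h), Nat.succ_sub_succ,
      pow_succ]
    ring

theorem bernoulliSum_mono {s : ℝ} (h0 : 0 ≤ s) (h1 : s ≤ 1) (A : Finset α) {u v : Finset α → ℝ}
    (h : ∀ I, u I ≤ v I) : bernoulliSum s A u ≤ bernoulliSum s A v := by
  have : 0 ≤ 1 - s := by linarith
  exact Finset.sum_le_sum fun I _ => mul_le_mul_of_nonneg_left (h I) (by positivity)

theorem bernoulliSum_const_mul (s c : ℝ) (A : Finset α) (u : Finset α → ℝ) :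
    bernoulliSum s A (fun I => c * u I) = c * bernoulliSum s A u := by
  simp only [bernoulliSum, Finset.mul_sum]
  exact Finset.sum_congr rfl fun I _ => by ring

theorem bernoulliSum_pos {s : ℝ} (h0 : 0 ≤ s) (h1 : s < 1) (A : Finset α) {u : Finset α → ℝ}
    (h : ∀ I, 0 < u I) : 0 < bernoulliSum s A u := by
  have h1' : 0 < 1 - s := by linarith
  refine Finset.sum_pos' (fun I _ => mul_nonneg (by positivity) (h I).le) ⟨∅, by simp, ?_⟩
  have := h ∅
  simp only [Finset.card_empty, pow_zero]
  positivity

/-- If `u` decreases, but at most by a factor of two whenever an element is added to the set,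
then `u` cannot be much smaller than its average on sets of half the density. -/
theorem bernoulliSum_inv_mul_le_one [DecidableEq α] {s t : ℝ} (hs : 0 ≤ s) (hst : s ≤ t / 2)
    (ht : t < 1) (A : Finset α) {u : Finset α → ℝ} (hpos : ∀ I, 0 < u I)
    (hle : ∀ I a, u (insert a I) ≤ u I) (hle2 : ∀ I a, u I ≤ 2 * u (insert a I)) :
    bernoulliSum s A (fun I => (u I)⁻¹) * bernoulliSum t A u ≤ 1 := by
  have ht0 : 0 ≤ t := by linarith
  induction A using Finset.induction_on generalizing u with
  | empty => simp [bernoulliSum, (hpos ∅).ne']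
  | insert c A hc ih =>
    have ih₀ := ih hpos hle hle2
    have ih₁ := ih (u := fun I => u (insert c I)) (fun I => hpos _)
      (fun I a => by rw [Finset.insert_comm]; exact hle _ _)
      (fun I a => by rw [Finset.insert_comm]; exact hle2 _ _)
    have ha := bernoulliSum_pos ht0 ht A hpos
    have hb := bernoulliSum_pos ht0 ht A (u := fun I => u (insert c I)) fun I => hpos _
    have hba := bernoulliSum_mono ht0 ht.le A fun I => hle I c
    have hab := bernoulliSum_mono ht0 ht.le A fun I => hle2 I c
    rw [bernoulliSum_const_mul] at hab
    rw [bernoulliSum_insert s hc, bernoulliSum_insert t hc]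
    set a := bernoulliSum t A u
    set b := bernoulliSum t A fun I => u (insert c I)
    set x := bernoulliSum s A fun I => (u I)⁻¹
    set y := bernoulliSum s A fun I => (u (insert c I))⁻¹
    -- Conditioning on whether c is in the set leaves an inequality in a and b alone, where b ≤ a ≤
    -- 2b.
    have hx : x ≤ 1 / a := by rwa [le_div_iff₀ ha]
    have hy : y ≤ 1 / b := by rwa [le_div_iff₀ hb]
    have hab' : 0 < (1 - t) * a + t * b := by
      have : 0 < (1 - t) * a := mul_pos (by linarith) ha
      have : 0 ≤ t * b := mul_nonneg ht0 hb.le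
      linarith
    calc ((1 - s) * x + s * y) * ((1 - t) * a + t * b)
        ≤ ((1 - s) * (1 / a) + s * (1 / b)) * ((1 - t) * a + t * b) := by
          have : 0 ≤ 1 - s := by linarith
          gcongr
      _ = (((1 - s) * b + s * a) * ((1 - t) * a + t * b)) / (a * b) := by
          field_simp
      _ ≤ 1 := by
          -- The claim is (b + s(a - b))(a - t(a - b)) ≤ ab; it holds because sa ≤ (t/2)(2b) = tb.
          rw [div_le_one (by positivity)]
          have h₁ : 0 ≤ a - b := by linarith
          have h₂ : 0 ≤ (t / 2 - s) * (a - b) * ((1 - t) * a + t * b) :=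
            mul_nonneg (mul_nonneg (by linarith) h₁) hab'.le
          have h₃ : 0 ≤ t * (a - b) * ((1 - t) * (2 * b - a)) :=
            mul_nonneg (mul_nonneg ht0 h₁) (mul_nonneg (by linarith) (by linarith))
          have h₄ : 0 ≤ t * (a - b) * (t * b) :=
            mul_nonneg (mul_nonneg ht0 h₁) (mul_nonneg ht0 hb.le)
          nlinarith

open scoped Classical in
theorem uniformProb_zeroOutside_eq {ι R : Type*} [Fintype ι] [DecidableEq ι] [Fintype R]
    [AddCommGroup R] (I : Finset ι) (P : (ι → R) → Prop) :
    uniformProb (fun x => P (zeroOutside I x)) =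
      ∑ z ∈ Finset.univ.filter P, (1 / (Fintype.card R : ℝ)) ^ I.card *
        ∏ i ∈ Finset.univ \ I, (if z i = 0 then (1 : ℝ) else 0) := by
  have hR : (Fintype.card R : ℝ) ≠ 0 := by simp
  have hfib : ∀ z : ι → R, ((Finset.univ.filter fun x => zeroOutside I x = z).card : ℝ) =
      ∏ i ∈ Finset.univ \ I, ((Fintype.card R : ℝ) * if z i = 0 then 1 else 0) := by
    intro z
    have : (Finset.univ.filter fun x => zeroOutside I x = z) = Fintype.piFinset fun i =>
        if i ∈ I then {z i} else if z i = 0 then Finset.univ else ∅ := by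
      ext x
      simp only [Finset.mem_filter, Finset.mem_univ, true_and, Fintype.mem_piFinset, funext_iff]
      refine forall_congr' fun i => ?_
      by_cases hi : i ∈ I
      · simp [zeroOutside, hi]
      · by_cases hz : z i = 0
        · simp [zeroOutside, hi, hz]
        · simp [zeroOutside, hi, hz, Ne.symm hz]
    rw [this, Fintype.card_piFinset, Nat.cast_prod, ← Finset.prod_sdiff (Finset.subset_univ I)]
    rw [Finset.prod_eq_one (s := I) fun i hi => by simp [hi], mul_one]
    refine Finset.prod_congr rfl fun i hi => ?_
    have hi' : i ∉ I := by simpa using hi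
    by_cases hz : z i = 0 <;> simp [hi', hz]
  rw [uniformProb, div_eq_iff (by simp), Finset.sum_mul]
  have hmaps := Finset.card_eq_sum_card_fiberwise
    (s := Finset.univ.filter fun x : ι → R => P (zeroOutside I x)) (t := Finset.univ.filter P)
    (f := zeroOutside I) (by intro x hx; simpa using hx)
  rw [hmaps, Nat.cast_sum]
  refine Finset.sum_congr rfl fun z hz => ?_
  have hz' : P z := by simpa using hz
  have : ((Finset.univ.filter fun x : ι → R => P (zeroOutside I x)).filter
      fun x => zeroOutside I x = z) = Finset.univ.filter fun x => zeroOutside I x = z := by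
    ext x
    simp only [Finset.mem_filter, Finset.mem_univ, true_and, and_iff_right_iff_imp]
    rintro rfl
    exact hz'
  rw [this, hfib, Finset.prod_mul_distrib, Finset.prod_const, Fintype.card_fun,
    Finset.card_sdiff_of_subset (Finset.subset_univ I), Finset.card_univ, one_div, inv_pow]
  have hle : I.card ≤ Fintype.card ι := Finset.card_le_univ I
  obtain ⟨m, hm⟩ := exists_add_of_le hle
  rw [hm, Nat.add_sub_cancel_left, Nat.cast_pow, pow_add]
  field_simp

/-- Here I is the set of resampled coordinates: expanding the product of the symbol probabilities is
a sum over I. -/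
theorem noiseProb_eq_bernoulliSum {R : Type*} [Fintype R] [AddCommGroup R] {n : ℕ} (ρ : ℝ)
    (P : (Fin n → R) → Prop) :
    noiseProb ρ 0 P = bernoulliSum (1 - ρ) Finset.univ
      fun I => uniformProb fun x => P (zeroOutside I x) := by
  classical
  simp only [noiseProb, channelProb, channelSymbolProb, bernoulliSum, uniformProb_zeroOutside_eq]
  simp only [add_comm (ρ * _), Finset.prod_add, Finset.mul_sum]
  rw [Finset.sum_comm]
  refine Finset.sum_congr rfl fun I _ => ?_
  refine Finset.sum_congr (by congr!) fun z _ => ?_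
  rw [Finset.prod_const, Finset.prod_mul_distrib, Finset.prod_const,
    Finset.card_sdiff_of_subset (Finset.subset_univ I), mul_pow]
  simp only [Pi.zero_apply, sub_sub_cancel]
  ring_nf

/-- Under a uniform colouring, each element independently gets a colour in S with probability
|S|/|C|. -/
theorem sum_colouring_eq_bernoulliSum [Fintype α] [DecidableEq α] {C : Type*} [Fintype C]
    [DecidableEq C] [Nonempty C] (S : Finset C) (F : Finset α → ℝ) :
    ∑ χ : α → C, F (Finset.univ.filter fun i => χ i ∈ S) =
      (Fintype.card (α → C) : ℝ) * bernoulliSum (S.card / Fintype.card C) Finset.univ F := by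
  have hC : (Fintype.card C : ℝ) ≠ 0 := by simp
  have hfib : ∀ I : Finset α,
      ((Finset.univ.filter fun χ : α → C => (Finset.univ.filter fun i => χ i ∈ S) = I).card : ℝ) =
      S.card ^ I.card * (Fintype.card C - S.card : ℝ) ^ (Fintype.card α - I.card) := by
    intro I
    have : (Finset.univ.filter fun χ : α → C => (Finset.univ.filter fun i => χ i ∈ S) = I) =
        Fintype.piFinset fun i => if i ∈ I then S else Sᶜ := by
      ext χ
      simp only [Finset.mem_filter, Finset.mem_univ, true_and, Fintype.mem_piFinset,
        Finset.ext_iff]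
      refine forall_congr' fun i => ?_
      by_cases hi : i ∈ I <;> simp [hi]
    rw [this, Fintype.card_piFinset, Nat.cast_prod, ← Finset.prod_sdiff (Finset.subset_univ I),
      mul_comm]
    congr 1
    · rw [Finset.prod_congr rfl fun i hi => by rw [if_pos hi], Finset.prod_const]
    · rw [Finset.prod_congr rfl fun i hi => by rw [if_neg (Finset.mem_sdiff.1 hi).2],
        Finset.prod_const, Finset.card_sdiff_of_subset (Finset.subset_univ I), Finset.card_univ,
        Finset.card_compl, Nat.cast_sub (Finset.card_le_univ S)]
  rw [← Finset.sum_fiberwise_of_maps_to (t := Finset.univ)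
    (g := fun χ : α → C => Finset.univ.filter fun i => χ i ∈ S) (by simp), bernoulliSum,
    Finset.powerset_univ, Finset.mul_sum]
  refine Finset.sum_congr rfl fun I _ => ?_
  rw [Finset.sum_congr rfl fun χ hχ => by rw [(Finset.mem_filter.1 hχ).2], Finset.sum_const,
    nsmul_eq_mul, hfib, Finset.card_univ, Fintype.card_fun]
  obtain ⟨m, hm⟩ := exists_add_of_le (Finset.card_le_univ I)
  rw [hm, Nat.add_sub_cancel_left, Nat.cast_pow, pow_add, one_sub_div hC, div_pow, div_pow]
  field_simp

end BernoulliSum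

/-! ### Descent to few colours, and the conclusion -/

/-- A recursive bound for functions of finite sets, unwound down to the small sets. -/
theorem le_pow_mul_sum_small {C : Type*} [Fintype C] [DecidableEq C] (D : ℕ)
    (g : Finset C → ℝ) (h0 : ∀ S, 0 ≤ g S)
    (h : ∀ S T, T ⊆ S → T.card = D → g S ≤ ∑ U ∈ T.powerset.erase ∅, g (S \ U)) (S : Finset C) :
    g S ≤ (2 ^ D) ^ S.card * ∑ S' ∈ Finset.univ.filter fun S' => S'.card < D, g S' := by
  set N := ∑ S' ∈ Finset.univ.filter fun S' => S'.card < D, g S'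
  have hN : 0 ≤ N := Finset.sum_nonneg fun S' _ => h0 S'
  have h2 : (1 : ℝ) ≤ 2 ^ D := one_le_pow₀ (by norm_num)
  induction S using Finset.strongInduction with
  | H S ih =>
    by_cases hS : S.card < D
    · have h₁ : g S ≤ N := Finset.single_le_sum (f := g) (fun S' _ => h0 S') (by simpa using hS)
      exact h₁.trans (le_mul_of_one_le_left hN (one_le_pow₀ h2))
    · obtain ⟨T, hTS, hT⟩ := Finset.exists_subset_card_eq (not_lt.1 hS)
      have hstep : ∀ U ∈ T.powerset.erase ∅, g (S \ U) ≤ (2 ^ D) ^ (S.card - 1) * N := by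
        intro U hU
        obtain ⟨hne, hUT⟩ := Finset.mem_erase.1 hU
        have hUS := (Finset.mem_powerset.1 hUT).trans hTS
        have hlt : S \ U ⊂ S :=
          Finset.sdiff_ssubset hUS (Finset.nonempty_iff_ne_empty.2 hne)
        refine (ih _ hlt).trans (mul_le_mul_of_nonneg_right (pow_le_pow_right₀ h2 ?_) hN)
        have := Finset.card_lt_card hlt
        omega
      -- An empty S reaches this branch only if D = 0; then the recursion bounds `g S` by an empty
      -- sum.
      rcases Nat.eq_zero_or_pos S.card with hS0 | hS0
      · have hTe : T = ∅ := Finset.card_eq_zero.1 (by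
          have := Finset.card_le_card hTS
          omega)
        have := h S T hTS hT
        rw [hTe] at this
        simp only [Finset.powerset_empty, Finset.erase_singleton, Finset.sum_empty] at this
        exact this.trans (by positivity)
      calc g S ≤ ∑ U ∈ T.powerset.erase ∅, g (S \ U) := h S T hTS hT
        _ ≤ ∑ U ∈ T.powerset.erase ∅, (2 ^ D) ^ (S.card - 1) * N := Finset.sum_le_sum hstep
        _ = (T.powerset.erase ∅).card * ((2 ^ D) ^ (S.card - 1) * N) := by
          rw [Finset.sum_const, nsmul_eq_mul]
        _ ≤ 2 ^ D * ((2 ^ D) ^ (S.card - 1) * N) := by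
          refine mul_le_mul_of_nonneg_right ?_ (by positivity)
          have := Finset.card_le_card (Finset.erase_subset ∅ T.powerset)
          rw [Finset.card_powerset, hT] at this
          exact_mod_cast this
        _ = (2 ^ D) ^ S.card * N := by
          obtain ⟨m, hm⟩ := Nat.exists_eq_add_of_le' hS0
          rw [hm, Nat.add_sub_cancel, pow_succ]
          ring

section Main

variable {p n k d : ℕ} [Fact p.Prime] {φ : (Fin n → ZMod p) → Fin k → ZMod p}

/-- Take the cube based at x restricted to S, with one direction per colour of T that erases this
colour: its vertices are the restrictions to S \ U. As the degree is below |T|, the alternating sum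
vanishes; solve for U = ∅. -/
theorem analyticRank_colouring_le {C : Type*} [DecidableEq C] (hφ : IsPolyMapLT (d + 2) φ)
    (χ : Fin n → C) (S T : Finset C) (hTS : T ⊆ S) (hT : T.card = d + 2) :
    analyticRank p n k (d + 1) (fun x => φ (zeroOutside (Finset.univ.filter fun i => χ i ∈ S) x)) ≤
      ∑ U ∈ T.powerset.erase ∅, analyticRank p n k (d + 1)
        (fun x => φ (zeroOutside (Finset.univ.filter fun i => χ i ∈ S \ U) x)) := by
  set ψ : Finset C → (Fin n → ZMod p) → Fin k → ZMod p :=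
    fun S x => φ (zeroOutside (Finset.univ.filter fun i => χ i ∈ S) x)
  have hψ : ∀ S, IsPolyMapLT (d + 2) (ψ S) := fun S => hφ.comp_zeroOutside _
  have hterm : ∀ U, IsPolyMapLT (d + 2)
      ((-1 : (Fin n → ZMod p) → Fin k → ZMod p) ^ U.card * ψ (S \ U)) := by
    intro U
    rcases neg_one_pow_eq_or ((Fin n → ZMod p) → Fin k → ZMod p) U.card with h | h
    · simpa [h] using hψ _
    · simpa [h] using (hψ _).neg
  have hrank : ∀ U, analyticRank p n k (d + 1)
      ((-1 : (Fin n → ZMod p) → Fin k → ZMod p) ^ U.card * ψ (S \ U)) =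
        analyticRank p n k (d + 1) (ψ (S \ U)) := by
    intro U
    rcases neg_one_pow_eq_or ((Fin n → ZMod p) → Fin k → ZMod p) U.card with h | h
    · simp [h]
    · simp [h, analyticRank_neg]
  have hzero : ∑ U ∈ T.powerset,
      (-1 : (Fin n → ZMod p) → Fin k → ZMod p) ^ U.card * ψ (S \ U) = 0 := by
    ext x j
    have hdeg : IsPolyLT T.card (fun x => φ x j) := hT ▸ hφ j
    have h := hdeg.alternating_sum T (fun c => -zeroOutside (Finset.univ.filter fun i => χ i = c) x)
      (zeroOutside (Finset.univ.filter fun i => χ i ∈ S) x)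
    rw [Finset.sum_apply, Finset.sum_apply, Pi.zero_apply, Pi.zero_apply, ← h]
    refine Finset.sum_congr rfl fun U hU => ?_
    have hUS := (Finset.mem_powerset.1 hU).trans hTS
    simp only [Pi.mul_apply, Pi.pow_apply, Pi.neg_apply, Pi.one_apply, ψ]
    congr 3
    ext i
    simp only [zeroOutside, Finset.mem_filter, Finset.mem_univ, true_and, Pi.add_apply,
      Finset.sum_apply, Pi.neg_apply, Finset.mem_sdiff, Finset.sum_neg_distrib, Finset.sum_ite_eq]
    by_cases hU' : χ i ∈ U
    · simp [hU', hUS hU']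
    · simp [hU']
  have hS : ψ S = -∑ U ∈ T.powerset.erase ∅,
      (-1 : (Fin n → ZMod p) → Fin k → ZMod p) ^ U.card * ψ (S \ U) := by
    rw [← Finset.add_sum_erase _ _ (Finset.empty_mem_powerset T)] at hzero
    simp only [Finset.card_empty, pow_zero, one_mul, Finset.sdiff_empty] at hzero
    exact eq_neg_of_add_eq_zero_left hzero
  change analyticRank p n k (d + 1) (ψ S) ≤ _
  rw [hS, analyticRank_neg]
  refine (analyticRank_sum_le _ fun U _ => hterm U).trans (le_of_eq ?_)
  exact Finset.sum_congr rfl fun U _ => hrank U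

/-- If the biased distribution of `φ` has a large atom, then the restrictions of `φ` to sparse
random sets of coordinates have bounded rank on average. -/
theorem bernoulliSum_analyticRank_le (hφ : IsPolyMapLT (d + 2) φ) {ρ ε s : ℝ}
    (hρ : ρ ∈ Set.Ioo (0 : ℝ) 1) (hε : 0 < ε) (hs : 0 ≤ s) (hsρ : s ≤ (1 - ρ) / 2)
    (y : Fin n → ZMod p) (w : Fin k → ZMod p)
    (h : ε ≤ noiseProb ρ (0 : Fin n → ZMod p) (fun z => φ (y + z) = w)) :
    bernoulliSum s Finset.univ
      (fun I => analyticRank p n k (d + 1) fun x => φ (zeroOutside I x)) ≤ 1 / ε := by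
  obtain ⟨hρ0, hρ1⟩ := hρ
  set r : Finset (Fin n) → ℝ := fun I => analyticRank p n k (d + 1) fun x => φ (zeroOutside I x)
  have hr0 : ∀ I, 0 ≤ r I := fun I => analyticRank_nonneg
  have hE : ε ≤ bernoulliSum (1 - ρ) Finset.univ fun I => (2 : ℝ) ^ (-r I) := by
    refine h.trans ?_
    rw [noiseProb_eq_bernoulliSum]
    refine bernoulliSum_mono (by linarith) (by linarith) _ fun I => ?_
    refine (uniformProb_zeroOutside_le hφ I y w).trans ?_
    refine Real.rpow_le_rpow_of_nonpos (by norm_num) ?_ (by linarith [hr0 I])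
    exact_mod_cast (Fact.out : p.Prime).two_le
  have hmain := bernoulliSum_inv_mul_le_one hs hsρ (by linarith) (Finset.univ : Finset (Fin n))
    (u := fun I => (2 : ℝ) ^ (-r I)) (fun I => by positivity)
    (fun I a => Real.rpow_le_rpow_of_exponent_le (by norm_num) (neg_le_neg
      (analyticRank_zeroOutside_mono hφ (Finset.subset_insert a I))))
    (fun I a => by
      have h₁ : r (insert a I) ≤ r I + 1 := analyticRank_zeroOutside_insert_le hφ a I
      calc (2 : ℝ) ^ (-r I) ≤ 2 ^ (1 + -r (insert a I)) :=
            Real.rpow_le_rpow_of_exponent_le (by norm_num) (by linarith)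
        _ = _ := by rw [Real.rpow_add (by norm_num), Real.rpow_one])
  have hr : bernoulliSum s Finset.univ r ≤
      bernoulliSum s Finset.univ fun I => ((2 : ℝ) ^ (-r I))⁻¹ := by
    refine bernoulliSum_mono hs (by linarith) _ fun I => ?_
    rw [Real.rpow_neg (by norm_num), inv_inv]
    -- This is r ≤ 2^r, by Bernoulli's inequality 1 + r ≤ 2^r when r ≥ 1.
    rcases le_total (r I) 1 with h₁ | h₁
    · exact h₁.trans (Real.one_le_rpow (by norm_num) (hr0 I))
    · have := one_add_mul_self_le_rpow_one_add (s := 1) (by norm_num) h₁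
      norm_num at this
      linarith
  refine hr.trans ?_
  rw [le_div_iff₀ hε]
  refine le_trans (mul_le_mul_of_nonneg_left hE ?_) hmain
  exact Finset.sum_nonneg fun I _ => by
    have : 0 ≤ 1 - s := by linarith
    positivity

end Main

theorem lemma5p2 (d : ℕ) (hd : 1 ≤ d) (ρ ε : ℝ) (hρ : ρ ∈ Set.Ioo (0 : ℝ) 1)
    (hε : ε ∈ Set.Ioo (0 : ℝ) 1) :
    ∃ R₀ : ℝ, 0 < R₀ ∧
      ∀ (p : ℕ) [Fact p.Prime] (n k : ℕ) (φ : (Fin n → ZMod p) → (Fin k → ZMod p)),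
        φ ∈ polyMaps p n k d → R₀ ≤ analyticRank p n k d φ →
          ∀ (y : Fin n → ZMod p) (w : Fin k → ZMod p),
            noiseProb ρ (0 : Fin n → ZMod p) (fun z => φ (y + z) = w) ≤ ε := by
  obtain ⟨d, rfl⟩ := Nat.exists_eq_add_of_le' hd
  obtain ⟨hε0, hε1⟩ := hε
  have hρ' : 0 < 1 - ρ := by linarith [hρ.2]
  -- With this many colours, at most `d + 1` of them have total density at most (1 - ρ)/2.
  obtain ⟨M, hM⟩ := exists_nat_ge ((d + 1) / ((1 - ρ) / 2))
  rw [div_le_iff₀ (by positivity)] at hM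
  have hM0 : 0 < M := by
    rcases Nat.eq_zero_or_pos M with rfl | h
    · have : (0 : ℝ) ≤ d := by positivity
      simp only [Nat.cast_zero, zero_mul] at hM
      linarith
    · exact h
  have hM0' : (0 : ℝ) < M := by exact_mod_cast hM0
  have : Nonempty (Fin M) := ⟨⟨0, hM0⟩⟩
  set small : Finset (Finset (Fin M)) := Finset.univ.filter fun S => S.card < d + 2
  -- The descent from all M colours costs the power of two; each small colour set contributes at
  -- most 1/ε on average.
  set K : ℝ := (2 ^ (d + 2)) ^ M * (small.card * (1 / ε))
  have hK : 0 ≤ K := by positivity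
  refine ⟨K + 1, by linarith, fun p _ n k φ hφ hR y w => ?_⟩
  rw [mem_polyMaps_iff] at hφ
  by_contra! hlt
  set r : Finset (Fin n) → ℝ := fun I => analyticRank p n k (d + 1) fun x => φ (zeroOutside I x)
  have hsmall : ∀ S ∈ small, ∑ χ : Fin n → Fin M, r (Finset.univ.filter fun i => χ i ∈ S) ≤
      Fintype.card (Fin n → Fin M) * (1 / ε) := by
    intro S hS
    rw [sum_colouring_eq_bernoulliSum]
    refine mul_le_mul_of_nonneg_left (bernoulliSum_analyticRank_le hφ hρ hε0 (by positivity) ?_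
      y w hlt.le) (by positivity)
    rw [Fintype.card_fin, div_le_iff₀ hM0']
    have : S.card < d + 2 := by simpa [small] using hS
    have : (S.card : ℝ) ≤ d + 1 := by exact_mod_cast Nat.lt_succ_iff.1 this
    linarith
  have hχ : ∀ χ : Fin n → Fin M, analyticRank p n k (d + 1) φ ≤
      (2 ^ (d + 2)) ^ M * ∑ S ∈ small, r (Finset.univ.filter fun i => χ i ∈ S) := by
    intro χ
    have := le_pow_mul_sum_small (d + 2) (fun S => r (Finset.univ.filter fun i => χ i ∈ S))
      (fun S => analyticRank_nonneg) (analyticRank_colouring_le hφ χ) Finset.univ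
    simpa [r, small, zeroOutside_univ] using this
  have hsum := Finset.sum_le_sum fun χ (_ : χ ∈ Finset.univ) => hχ χ
  rw [Finset.sum_const, nsmul_eq_mul, Finset.card_univ, ← Finset.mul_sum, Finset.sum_comm] at hsum
  have hsum' := Finset.sum_le_sum hsmall
  rw [Finset.sum_const, nsmul_eq_mul] at hsum'
  have hN : (0 : ℝ) < Fintype.card (Fin n → Fin M) := by exact_mod_cast Fintype.card_pos
  have hfin : (Fintype.card (Fin n → Fin M) : ℝ) * analyticRank p n k (d + 1) φ ≤
      Fintype.card (Fin n → Fin M) * K := by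
    refine hsum.trans ((mul_le_mul_of_nonneg_left hsum' (by positivity)).trans (le_of_eq ?_))
    simp only [K]
    ring
  have := le_of_mul_le_mul_left hfin hN
  linarith
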